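/- Let $G$ be a finite undirected graph without loops and multiple edges, and let $k$ be a positive integer. Distances in $G$ are the usual shortest-path distances (infinite between different components). A $k$-packing is a set of vertices whose distinct members are pairwise at distance larger than $k$; $\rho_k(G)$ is the maximum size of a $k$-packing. A $k$-domination set is a set $D$ of vertices such that every vertex of $G$ is at distance at most $k$ from some vertex of $D$; $\gamma_k(G)$ is the minimum size of a $k$-domination set. The graph $G$ is $k$-equipackable if all its inclusion-maximal $k$-packings have the same size, and $\mathcal{R}_k$ is the class of finite graphs with $\rho_k(G)=\rho_{2k}(G)$. A graph is chordal if it has no induced cycle of length at least $4$. A sun is a chordal graph whose vertex set can be partitioned, for some $n\ge 3$, into two sets $X=\{x_1,\dots,x_n\}$ and $Y=\{y_1,\dots,y_n\}$ of $n$ vertices each such that $X$ is independent, $y_iy_{i+1}$ is an edge for every $i$, and $x_iy_j$ is an edge if and only if $i=j$ or $i=j+1$ (indices modulo $n$). A chordal graph is sun-free chordal if it has no sun as an induced subgraph. Theorem. If $G$ is sun-free chordal, then $$\gamma_k(G)=\rho_k(G)\quad\Longleftrightarrow\quad \rho_k(G)=\rho_{2k}(G),\ \text{i.e. } G\in\mathcal{R}_k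 .$$ Moreover, for every finite graph $G$ (sun-free chordal or not), each of the two conditions $\gamma_k(G)=\rho_k(G)$ and $G\in\mathcal{R}_k$ implies that $G$ is $k$-equipackable. In particular, all sun-free chordal graphs that satisfy these equivalent conditions are $k$-equipackable. -/

import Mathlib

namespace GraphPacking

variable {V : Type*}

/-- `P` is a `k`-packing: any two distinct vertices of `P` are at distance larger than `k`.
The distance is `ℕ∞`-valued: vertices in different components are at distance `⊤`. -/
def IsPacking (G : SimpleGraph V) (k : ℕ) (P : Finset V) : Prop :=
  ∀ u ∈ P, ∀ v ∈ P, u ≠ v → (k : ℕ∞) < G.edist u v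

/-- `D` is a `k`-domination set (`k`-covering): every vertex of `G` is at distance at most `k`
from some vertex of `D`. -/
def IsDominating (G : SimpleGraph V) (k : ℕ) (D : Finset V) : Prop :=
  ∀ v : V, ∃ d ∈ D, G.edist d v ≤ (k : ℕ∞)

/-- The `k`-packing number `ρ_k(G)`: the maximum size of a `k`-packing (for finite graphs). -/
noncomputable def packingNumber (G : SimpleGraph V) (k : ℕ) : ℕ :=
  sSup {n : ℕ | ∃ P : Finset V, IsPacking G k P ∧ P.card = n}

/-- The `k`-domination number `γ_k(G)`: the minimum size of a `k`-domination set
(for finite graphs). -/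
noncomputable def dominationNumber (G : SimpleGraph V) (k : ℕ) : ℕ :=
  sInf {n : ℕ | ∃ D : Finset V, IsDominating G k D ∧ D.card = n}

/-- `G` is in the class `R_k`: its `k`-packing and `2k`-packing numbers are equal. -/
def InClassR (k : ℕ) (G : SimpleGraph V) : Prop :=
  packingNumber G k = packingNumber G (2 * k)

/-- `G` is `k`-equipackable: all its inclusion-maximal `k`-packings are of the same size. -/
def IsEquipackable (k : ℕ) (G : SimpleGraph V) : Prop :=
  ∀ P Q : Finset V, Maximal (IsPacking G k) P → Maximal (IsPacking G k) Q → P.card = Q.card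

/-- `G` is chordal: it has no induced cycle of length at least four. -/
def IsChordal (G : SimpleGraph V) : Prop :=
  ∀ n : ℕ, 4 ≤ n → ¬ (SimpleGraph.cycleGraph n).IsIndContained G

/-- `G` is a sun: a chordal graph whose vertex set is partitioned, for some `n ≥ 3`, into
`{x_i}` and `{y_i}` (indices modulo `n`) such that the `x_i` are independent, the `y_i` form a
(not necessarily chordless) cycle in this order, and `x_i` is adjacent to `y_i` and `y_{i-1}`
and to no other `y_j`. -/
def IsSun (G : SimpleGraph V) : Prop :=
  IsChordal G ∧ ∃ n : ℕ, 3 ≤ n ∧ ∃ x y : ZMod n → V,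
    Function.Bijective (Sum.elim x y) ∧
    (∀ i j, ¬ G.Adj (x i) (x j)) ∧
    (∀ i, G.Adj (y i) (y (i + 1))) ∧
    (∀ i j, G.Adj (x i) (y j) ↔ i = j ∨ i = j + 1)

/-- `G` is sun-free chordal: it is chordal and no induced subgraph of `G` is a sun. -/
def IsSunFreeChordal (G : SimpleGraph V) : Prop :=
  IsChordal G ∧ ∀ S : Set V, ¬ IsSun (G.induce S)

end GraphPacking

/-! Maximal `k`-packings are `k`-domination sets, and a `k`-domination set needs a separate vertex
for each member of a `2k`-packing. Hence `ρ_2k ≤ γ_k ≤ ρ_k` in every finite graph, so that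
`ρ_k = ρ_2k` forces `γ_k = ρ_k`, and `γ_k = ρ_k` forces all maximal `k`-packings to have size `ρ_k`.

For the remaining implication, let `G` be sun-free chordal. It is enough to show that an
equipackable `G` satisfies `ρ_k ≤ ρ_2k`, and for this it suffices that the `k`-th power of `G` is
chordal, since `k`-packings of `G` are the independent sets of that power.

The power is chordal by induction on `k` in steps of two (`IsChordal.powerGraph_add_two`), starting
from `G` itself and from its square, where an induced cycle would give a sun in `G`
(`IsSunFreeChordal.powerGraph_two`). Both rest on `IsChordal.touch_or_touch`: in a chordal graph
there are no four connected sets touching in cyclic order and separated across both diagonals.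

In a chordal graph `H` all of whose maximal independent sets have the same size, the vertices are
partitioned into that many cliques, so each maximal independent set meets every clique of the
partition. If every vertex of one of the cliques had a neighbour outside of it, an independent set
outside the clique would dominate it (`IsChordal.exists_independent_dominating_clique`) and extend
to a maximal one missing it. So each clique contains a closed neighbourhood of one of its vertices.
Vertices chosen in this way, one from each clique, have disjoint closed neighbourhoods, which for
the `k`-th power means that they form a `2k`-packing of size `ρ_k` (`IsEquipackable.inClassR`).
-/

namespace GraphPacking

variable {V : Type*}

/-! ### Simplicial vertices of chordal graphs -/

theorem not_isChordal_of_cycle {H : SimpleGraph V} {n : ℕ} (hn : 4 ≤ n) (c : ℕ → V)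
    (hinj : ∀ i j, i < j → j < n → c i ≠ c j)
    (hadj : ∀ i j, i < j → j < n → (H.Adj (c i) (c j) ↔ j = i + 1 ∨ i = 0 ∧ j = n - 1)) :
    ¬ IsChordal H := by
  intro hH
  refine hH n hn ⟨⟨⟨fun i => c i, ?_⟩, ?_⟩⟩
  · intro i j hij
    rcases lt_trichotomy i j with h | h | h
    · exact absurd hij (hinj i j h j.2)
    · exact h
    · exact absurd hij.symm (hinj j i h i.2)
  · intro i j
    have key : ∀ i j : Fin n, i < j →
        (H.Adj (c i) (c j) ↔ (SimpleGraph.cycleGraph n).Adj i j) := by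
      intro i j hij
      have hj := j.2
      have hlt : (i : ℕ) < j := hij
      rw [hadj i j hij j.2, SimpleGraph.cycleGraph_adj', Fin.sub_val_of_le hij.le,
        Fin.val_sub, Nat.mod_eq_of_lt (a := n - ↑j + ↑i) (by omega)]
      omega
    rcases lt_trichotomy i j with h | h | h
    · exact key i j h
    · subst h; simp
    · have := key j i h
      rw [SimpleGraph.adj_comm, SimpleGraph.adj_comm (SimpleGraph.cycleGraph n)]
      exact this

/-- The basic use of chordality: if `v` has no neighbour in a connected piece of `W` that is adjacent
to both `y` and `z`, then its neighbours `y` and `z` are adjacent. Otherwise a shortest path from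
`y` to `z` through `W`, closed up by `v`, is an induced cycle of length at least four. -/
theorem adj_of_separated {H : SimpleGraph V} (hH : IsChordal H) {v y z : V} {W : Set V}
    (hvy : H.Adj v y) (hvz : H.Adj v z) (hyz : y ≠ z) (hvW : v ∉ W)
    (hW : ∀ w ∈ W, ¬ H.Adj v w) {a b : W} (hya : H.Adj y a) (hzb : H.Adj z b)
    (hab : (H.induce W).Reachable a b) : H.Adj y z := by
  by_contra hnadj
  set X : Set V := insert y (insert z W) with hX
  have hWX : W ⊆ X := fun w hw => Or.inr (Or.inr hw)
  have hyX : y ∈ X := Or.inl rfl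
  have hzX : z ∈ X := Or.inr (Or.inl rfl)
  have hreach : (H.induce X).Reachable ⟨y, hyX⟩ ⟨z, hzX⟩ := by
    have h1 : (H.induce X).Adj ⟨y, hyX⟩ ⟨a, hWX a.2⟩ := hya
    have h2 : (H.induce X).Adj ⟨b, hWX b.2⟩ ⟨z, hzX⟩ := hzb.symm
    exact (h1.reachable.trans (hab.map (SimpleGraph.induceHomOfLE H hWX).toHom)).trans
      h2.reachable
  obtain ⟨p, hp, hlen⟩ := hreach.exists_path_of_dist
  set m := p.length with hm
  let q : ℕ → V := fun i => (p.getVert i : V)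
  have q0 : q 0 = y := by simp [q]
  have qm : q m = z := by simp [q, hm]
  have qadj : ∀ i, i < m → H.Adj (q i) (q (i + 1)) := fun i hi => p.adj_getVert_succ hi
  have qinj : ∀ i j, i ≤ m → j ≤ m → q i = q j → i = j := fun i j hi hj h =>
    hp.getVert_injOn hi hj (Subtype.ext h)
  have qchord : ∀ i j, i < j → j ≤ m → H.Adj (q i) (q j) → j = i + 1 := by
    intro i j hij hj h
    have h' : (H.induce X).Adj (p.getVert i) (p.getVert j) := h
    have := SimpleGraph.dist_le (((p.take i).append h'.toWalk).append (p.drop j))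
    simp only [SimpleGraph.Walk.length_append, SimpleGraph.Walk.take_length,
      SimpleGraph.Walk.drop_length, SimpleGraph.Walk.length_cons,
      SimpleGraph.Walk.length_nil] at this
    omega
  have hm0 : m ≠ 0 := fun h => hyz (by rw [← q0, ← qm, h])
  have hm1 : m ≠ 1 := fun h => hnadj (by
    have := qadj 0 (by omega)
    rw [q0, zero_add, ← h, qm] at this
    exact this)
  have qW : ∀ i, 0 < i → i < m → q i ∈ W := by
    intro i h0 hi
    have : q i ∈ X := (p.getVert i).2
    rcases this with h | h | h
    · have := qinj i 0 hi.le (by omega) (by rw [h, q0]); omega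
    · have := qinj i m hi.le le_rfl (by rw [qm]; exact h); omega
    · exact h
  have qv : ∀ i, i ≤ m → (H.Adj (q i) v ↔ i = 0 ∨ i = m) := by
    intro i hi
    constructor
    · intro h
      by_contra hne
      exact hW _ (qW i (by omega) (by omega)) h.symm
    · rintro (rfl | rfl)
      · rw [q0]; exact hvy.symm
      · rw [qm]; exact hvz.symm
  have qnv : ∀ i, i ≤ m → q i ≠ v := by
    intro i hi h
    by_cases h' : i = 0 ∨ i = m
    · have := (qv i hi).2 h'
      rw [h] at this
      exact this.ne rfl
    · exact hvW (h ▸ qW i (by omega) (by omega))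
  refine not_isChordal_of_cycle (n := m + 2) (by omega) (fun i => if i ≤ m then q i else v)
    ?_ ?_ hH
  · intro i j hij hj
    have hi : i ≤ m := by omega
    by_cases hjm : j ≤ m
    · simp only [hi, hjm, if_true]
      intro h
      have := qinj i j hi hjm h
      omega
    · simp only [hi, hjm, if_true, if_false]
      exact qnv i hi
  · intro i j hij hj
    have hi : i ≤ m := by omega
    by_cases hjm : j ≤ m
    · simp only [hi, hjm, if_true]
      constructor
      · intro h
        exact Or.inl (qchord i j hij hjm h)
      · rintro (rfl | h)
        · exact qadj i (by omega)
        · omega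
    · simp only [hi, hjm, if_true, if_false]
      rw [qv i hi]
      omega

/-- `s` is a simplicial vertex of the subgraph of `H` induced on `U`: it lies in `U` and its
neighbours in `U` form a clique. -/
def IsSimplicialIn (H : SimpleGraph V) (U : Set V) (s : V) : Prop :=
  s ∈ U ∧ ∀ a ∈ U, ∀ b ∈ U, H.Adj s a → H.Adj s b → a ≠ b → H.Adj a b

/-- Dirac's theorem, in the form that any proper clique `C` of an induced subgraph of a chordal
graph can be avoided: some simplicial vertex lies outside `C`. The induction passes to a component
`K` of the non-neighbours of a suitable vertex `v`, together with its boundary `N`, which is a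
clique by `adj_of_separated`; a simplicial vertex of `K ∪ N` outside `N` is simplicial in `U`. -/
theorem IsChordal.exists_isSimplicialIn_notMem [Finite V] {H : SimpleGraph V} (hH : IsChordal H)
    (U : Set V) : ∀ C : Set V, C ⊂ U → H.IsClique C → ∃ s, s ∉ C ∧ IsSimplicialIn H U s := by
  induction U using WellFoundedLT.induction with
  | ind U ih =>
  intro C hCU hC
  by_cases hU : H.IsClique U
  · obtain ⟨s, hsU, hsC⟩ := Set.exists_of_ssubset hCU
    exact ⟨s, hsC, hsU, fun a ha b hb _ _ hab => hU ha hb hab⟩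
  -- `v` has a non-neighbour, and `C` lies in the closed neighbourhood of `v`, so that every
  -- vertex of `K` below is outside `C`
  obtain ⟨v, hvU, u, huU, hvu, hnvu, hCv⟩ : ∃ v ∈ U, ∃ u ∈ U, v ≠ u ∧ ¬ H.Adj v u ∧
      ∀ c ∈ C, c = v ∨ H.Adj v c := by
    by_cases h : ∃ c ∈ C, ∃ u ∈ U, c ≠ u ∧ ¬ H.Adj c u
    · obtain ⟨c, hc, u, hu, hne, hn⟩ := h
      refine ⟨c, hCU.1 hc, u, hu, hne, hn, fun d hd => ?_⟩
      by_cases hdc : d = c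
      · exact Or.inl hdc
      · exact Or.inr (hC hc hd (Ne.symm hdc))
    · push Not at h
      simp only [SimpleGraph.IsClique, Set.Pairwise] at hU
      push Not at hU
      obtain ⟨v, hv, u, hu, hne, hn⟩ := hU
      refine ⟨v, hv, u, hu, hne, hn, fun d hd => ?_⟩
      by_cases hdv : d = v
      · exact Or.inl hdv
      · exact Or.inr (h d hd v hv hdv).symm
  set W : Set V := {w | w ∈ U ∧ w ≠ v ∧ ¬ H.Adj v w} with hWdef
  have huW : u ∈ W := ⟨huU, hvu.symm, hnvu⟩
  set K : Set V := {w | ∃ h : w ∈ W, (H.induce W).Reachable ⟨u, huW⟩ ⟨w, h⟩} with hK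
  set N : Set V := {y | y ∈ U ∧ y ∉ K ∧ ∃ w ∈ K, H.Adj y w} with hN
  have hKU : K ⊆ U := fun w hw => hw.1.1
  have huK : u ∈ K := ⟨huW, SimpleGraph.Reachable.refl _⟩
  have hNv : ∀ y ∈ N, H.Adj v y := by
    rintro y ⟨hyU, hyK, w, ⟨hwW, hw⟩, hyw⟩
    by_contra hnadj
    have hyv : y ≠ v := by
      rintro rfl
      exact hwW.2.2 hyw
    have hyW : y ∈ W := ⟨hyU, hyv, hnadj⟩
    have h' : (H.induce W).Adj ⟨w, hwW⟩ ⟨y, hyW⟩ := hyw.symm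
    exact hyK ⟨hyW, hw.trans h'.reachable⟩
  have hNclique : H.IsClique N := by
    intro y hy z hz hyz
    obtain ⟨-, -, a, ⟨haW, ha⟩, hya⟩ := id hy
    obtain ⟨-, -, b, ⟨hbW, hb⟩, hzb⟩ := id hz
    exact adj_of_separated hH (hNv y hy) (hNv z hz) hyz (fun h => h.2.1 rfl)
      (fun w hw => hw.2.2) (a := ⟨a, haW⟩) (b := ⟨b, hbW⟩) hya hzb (ha.symm.trans hb)
  have hlt : K ∪ N < U := by
    refine ⟨Set.union_subset hKU fun y hy => hy.1, fun h => ?_⟩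
    rcases h hvU with h | h
    · exact h.1.2.1 rfl
    · exact (hNv v h).ne rfl
  obtain ⟨s, hsN, hsKN, hs⟩ := ih (K ∪ N) hlt N
    ⟨Set.subset_union_right, fun h => (h (Or.inl huK)).2.1 huK⟩ hNclique
  have hsK : s ∈ K := hsKN.resolve_right hsN
  have hnb : ∀ a ∈ U, H.Adj s a → a ∈ K ∪ N := by
    intro a ha hsa
    by_cases haK : a ∈ K
    · exact Or.inl haK
    · exact Or.inr ⟨ha, haK, s, hsK, hsa.symm⟩
  refine ⟨s, fun hsC => ?_, hKU hsK, fun a ha b hb hsa hsb hab =>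
    hs a (hnb a ha hsa) b (hnb b hb hsb) hsa hsb hab⟩
  rcases hCv s hsC with h | h
  · exact hsK.1.2.1 h
  · exact hsK.1.2.2 h

theorem IsChordal.exists_isSimplicialIn [Finite V] {H : SimpleGraph V} (hH : IsChordal H)
    {U : Set V} (hU : U.Nonempty) : ∃ s, IsSimplicialIn H U s := by
  obtain ⟨s, -, hs⟩ := hH.exists_isSimplicialIn_notMem U ∅ hU.empty_ssubset (by simp)
  exact ⟨s, hs⟩

/-! ### Connected sets in chordal graphs -/

/-- Two sets of vertices touch if they share a vertex or are joined by an edge. -/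
def Touch (H : SimpleGraph V) (A B : Set V) : Prop :=
  ∃ a ∈ A, ∃ b ∈ B, H.Adj a b ∨ a = b

/-- `B` is nonempty and induces a connected subgraph of `H`, expressed as: every predicate that
is constant along the edges inside `B` is constant on `B`. -/
def IsConnSet (H : SimpleGraph V) (B : Set V) : Prop :=
  B.Nonempty ∧ ∀ p : V → Prop, (∀ a ∈ B, ∀ b ∈ B, H.Adj a b → p a → p b) →
    ∀ a ∈ B, ∀ b ∈ B, p a → p b

variable {H : SimpleGraph V} {A B C D U : Set V} {s : V}

theorem Touch.symm (h : Touch H A B) : Touch H B A := by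
  obtain ⟨a, ha, b, hb, h⟩ := h
  exact ⟨b, hb, a, ha, h.imp SimpleGraph.Adj.symm Eq.symm⟩

theorem Touch.mono (h : Touch H A B) (hA : A ⊆ C) (hB : B ⊆ D) : Touch H C D := by
  obtain ⟨a, ha, b, hb, h⟩ := h
  exact ⟨a, hA ha, b, hB hb, h⟩

theorem isConnSet_singleton (H : SimpleGraph V) (a : V) : IsConnSet H {a} := by
  refine ⟨Set.singleton_nonempty a, ?_⟩
  rintro p - x rfl y rfl h
  exact h

theorem IsConnSet.union (hA : IsConnSet H A) (hB : IsConnSet H B) (h : Touch H A B) :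
    IsConnSet H (A ∪ B) := by
  refine ⟨hA.1.inl, fun p hp => ?_⟩
  obtain ⟨a, ha, b, hb, h⟩ := h
  have h1 := hA.2 p fun x hx y hy => hp x (Or.inl hx) y (Or.inl hy)
  have h2 := hB.2 p fun x hx y hy => hp x (Or.inr hx) y (Or.inr hy)
  have hab : p a ↔ p b := by
    rcases h with h | rfl
    · exact ⟨hp a (Or.inl ha) b (Or.inr hb) h, hp b (Or.inr hb) a (Or.inl ha) h.symm⟩
    · exact Iff.rfl
  rintro x (hx | hx) y (hy | hy) hpx
  · exact h1 x hx y hy hpx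
  · exact h2 b hb y hy (hab.1 (h1 x hx a ha hpx))
  · exact h1 a ha y hy (hab.2 (h2 x hx b hb hpx))
  · exact h2 x hx y hy hpx

theorem isConnSet_star (H : SimpleGraph V) {B : Set V} {a : V} (ha : a ∈ B)
    (h : ∀ b ∈ B, H.Adj a b ∨ a = b) : IsConnSet H B := by
  refine ⟨⟨a, ha⟩, fun p hp => ?_⟩
  have key : ∀ b ∈ B, p b ↔ p a := by
    intro b hb
    rcases h b hb with h | rfl
    · exact ⟨hp b hb a ha h.symm, hp a ha b hb h⟩
    · exact Iff.rfl
  intro x hx y hy hpx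
  exact (key y hy).2 ((key x hx).1 hpx)

theorem IsConnSet.exists_adj (hB : IsConnSet H B) (hs : s ∈ B) (hne : B ≠ {s}) :
    ∃ t ∈ B, H.Adj s t := by
  by_contra! hno
  refine hne (Set.eq_singleton_iff_unique_mem.2 ⟨hs, fun b hb => ?_⟩)
  refine hB.2 (· = s) ?_ s hs b hb rfl
  rintro a - c hc hac rfl
  exact absurd hac (hno c hc)

/-- Deleting a simplicial vertex keeps a set connected, unless nothing is left. -/
theorem IsConnSet.diff_simplicial (hB : IsConnSet H B) (hs : IsSimplicialIn H U s)
    (hBU : B ⊆ U) (hne : B ≠ {s}) : IsConnSet H (B \ {s}) := by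
  by_cases hsB : s ∈ B
  swap
  · rwa [Set.sdiff_singleton_eq_self hsB]
  obtain ⟨t, ht, hst⟩ := hB.exists_adj hsB hne
  have hts : t ≠ s := hst.ne'
  refine ⟨⟨t, ht, hts⟩, fun p hp => ?_⟩
  -- extend `p` to `s` by its value at the neighbour `t`
  have key := hB.2 (fun x => (x = s ∧ p t) ∨ (x ≠ s ∧ p x)) (by
    have hnb : ∀ b ∈ B, H.Adj s b → (p t ↔ p b) := by
      intro b hb hsb
      by_cases hbt : b = t
      · rw [hbt]
      · have := hs.2 b (hBU hb) t (hBU ht) hsb hst hbt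
        exact ⟨hp t ⟨ht, hts⟩ b ⟨hb, hsb.ne'⟩ this.symm,
          hp b ⟨hb, hsb.ne'⟩ t ⟨ht, hts⟩ this⟩
    rintro a ha b hb hab (⟨rfl, hpt⟩ | ⟨has, hpa⟩)
    · exact Or.inr ⟨hab.ne', (hnb b hb hab).1 hpt⟩
    · by_cases hbs : b = s
      · exact Or.inl ⟨hbs, (hnb a ha (hbs ▸ hab.symm)).2 hpa⟩
      · exact Or.inr ⟨hbs, hp a ⟨ha, has⟩ b ⟨hb, hbs⟩ hab hpa⟩)
  intro a ha b hb hpa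
  rcases key a ha.1 b hb.1 (Or.inr ⟨ha.2, hpa⟩) with h | h
  · exact absurd h.1 hb.2
  · exact h.2

/-- Deleting a simplicial vertex from two touching connected sets keeps them touching, unless one
of them becomes empty: the deleted vertex can be replaced by one of its neighbours. -/
theorem Touch.diff_simplicial (h : Touch H A B) (hA : IsConnSet H A) (hB : IsConnSet H B)
    (hs : IsSimplicialIn H U s) (hAU : A ⊆ U) (hBU : B ⊆ U) (hneA : A ≠ {s}) (hneB : B ≠ {s}) :
    Touch H (A \ {s}) (B \ {s}) := by
  obtain ⟨a, ha, b, hb, h⟩ := h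
  have key : ∀ x ∈ U, ∀ y ∈ U, H.Adj s x → H.Adj s y → H.Adj x y ∨ x = y := by
    intro x hx y hy hsx hsy
    by_cases hxy : x = y
    · exact Or.inr hxy
    · exact Or.inl (hs.2 x hx y hy hsx hsy hxy)
  by_cases has : a = s <;> by_cases hbs : b = s
  · subst has
    obtain ⟨a', ha', h1⟩ := hA.exists_adj ha hneA
    subst hbs
    obtain ⟨b', hb', h2⟩ := hB.exists_adj hb hneB
    exact ⟨a', ⟨ha', h1.ne'⟩, b', ⟨hb', h2.ne'⟩, key a' (hAU ha') b' (hBU hb') h1 h2⟩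
  · subst has
    obtain ⟨a', ha', h1⟩ := hA.exists_adj ha hneA
    have h2 := h.resolve_right (Ne.symm hbs)
    exact ⟨a', ⟨ha', h1.ne'⟩, b, ⟨hb, hbs⟩, key a' (hAU ha') b (hBU hb) h1 h2⟩
  · subst hbs
    obtain ⟨b', hb', h2⟩ := hB.exists_adj hb hneB
    have h1 := (h.resolve_right has).symm
    exact ⟨a, ⟨ha, has⟩, b', ⟨hb', h2.ne'⟩, key a (hAU ha) b' (hBU hb') h1 h2⟩
  · exact ⟨a, ⟨ha, has⟩, b, ⟨hb, hbs⟩, h⟩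

theorem touch_of_simplicial (hs : IsSimplicialIn H U s) (hAU : A ⊆ U) (hBU : B ⊆ U)
    (hA : Touch H A {s}) (hB : Touch H {s} B) : Touch H A B := by
  obtain ⟨a, ha, t, rfl, h1⟩ := hA
  obtain ⟨t, rfl, b, hb, h2⟩ := hB
  refine ⟨a, ha, b, hb, ?_⟩
  rcases h1 with h1 | rfl
  · rcases h2 with h2 | rfl
    · by_cases hab : a = b
      · exact Or.inr hab
      · exact Or.inl (hs.2 a (hAU ha) b (hBU hb) h1.symm h2 hab)
    · exact Or.inl h1
  · exact h2

/-- Four connected sets that touch in cyclic order cannot be pairwise separated across the two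
diagonals in a chordal graph. Simplicial vertices of the union are deleted one by one, until one
of the sets is a single simplicial vertex; then its two neighbours in the cyclic order touch. This
is the only obstruction to chordality used for the powers of a graph. -/
theorem IsChordal.touch_or_touch [Finite V] (hH : IsChordal H) (hA : IsConnSet H A)
    (hB : IsConnSet H B) (hC : IsConnSet H C) (hD : IsConnSet H D) (hAB : Touch H A B)
    (hBC : Touch H B C) (hCD : Touch H C D) (hDA : Touch H D A) :
    Touch H A C ∨ Touch H B D := by
  obtain ⟨U, hU⟩ : ∃ U : Set V, U = A ∪ B ∪ C ∪ D := ⟨_, rfl⟩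
  induction U using WellFoundedLT.induction generalizing A B C D with
  | ind U ih =>
  have hAU : A ⊆ U := by rw [hU]; intro x hx; simp [hx]
  have hBU : B ⊆ U := by rw [hU]; intro x hx; simp [hx]
  have hCU : C ⊆ U := by rw [hU]; intro x hx; simp [hx]
  have hDU : D ⊆ U := by rw [hU]; intro x hx; simp [hx]
  obtain ⟨s, hs⟩ := hH.exists_isSimplicialIn (hA.1.mono hAU)
  by_cases h1 : A = {s}
  · subst h1; exact Or.inr (touch_of_simplicial hs hDU hBU hDA hAB).symm
  by_cases h2 : B = {s}
  · subst h2; exact Or.inl (touch_of_simplicial hs hAU hCU hAB hBC)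
  by_cases h3 : C = {s}
  · subst h3; exact Or.inr (touch_of_simplicial hs hBU hDU hBC hCD)
  by_cases h4 : D = {s}
  · subst h4; exact Or.inl (touch_of_simplicial hs hCU hAU hCD hDA).symm
  have hlt : U \ {s} < U := by
    refine ⟨Set.sdiff_subset, fun h => (h hs.1).2 rfl⟩
  refine (ih (U \ {s}) hlt (hA.diff_simplicial hs hAU h1) (hB.diff_simplicial hs hBU h2)
    (hC.diff_simplicial hs hCU h3) (hD.diff_simplicial hs hDU h4)
    (hAB.diff_simplicial hA hB hs hAU hBU h1 h2) (hBC.diff_simplicial hB hC hs hBU hCU h2 h3)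
    (hCD.diff_simplicial hC hD hs hCU hDU h3 h4) (hDA.diff_simplicial hD hA hs hDU hAU h4 h1)
    (by rw [hU]; simp only [Set.union_sdiff_distrib])).imp ?_ ?_ <;>
  exact fun h => h.mono Set.sdiff_subset Set.sdiff_subset

/-! ### Powers of a graph -/

/-- The `k`-th power of `G`: distinct vertices are adjacent if their distance in `G` is at most
`k`. -/
def powerGraph (G : SimpleGraph V) (k : ℕ) : SimpleGraph V where
  Adj u v := u ≠ v ∧ G.edist u v ≤ k
  symm := ⟨fun u v h => ⟨h.1.symm, by rw [SimpleGraph.edist_comm]; exact h.2⟩⟩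
  loopless := ⟨fun u h => h.1 rfl⟩

variable {G : SimpleGraph V} {k : ℕ}

theorem powerGraph_adj_or_eq {u v : V} :
    (powerGraph G k).Adj u v ∨ u = v ↔ G.edist u v ≤ k := by
  constructor
  · rintro (h | rfl)
    · exact h.2
    · simp
  · intro h
    by_cases huv : u = v
    · exact Or.inr huv
    · exact Or.inl ⟨huv, h⟩

theorem powerGraph_one (G : SimpleGraph V) : powerGraph G 1 = G := by
  ext u v
  have := SimpleGraph.edist_le_one_iff_adj_or_eq (G := G) (u := u) (v := v)
  constructor
  · rintro ⟨h1, h2⟩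
    exact (this.1 (by exact_mod_cast h2)).resolve_right h1
  · intro h
    exact ⟨h.ne, by exact_mod_cast this.2 (Or.inl h)⟩

theorem edist_le_add {u v w : V} {a b : ℕ} (h1 : G.edist u v ≤ a) (h2 : G.edist v w ≤ b) :
    G.edist u w ≤ (a + b : ℕ) := by
  push_cast
  exact SimpleGraph.edist_triangle.trans (add_le_add h1 h2)

theorem exists_edist_le_of_le_add {u v : V} {a b : ℕ} (h : G.edist u v ≤ (a + b : ℕ)) :
    ∃ w, G.edist u w ≤ a ∧ G.edist w v ≤ b := by
  obtain ⟨p, hp⟩ := SimpleGraph.exists_walk_of_edist_ne_top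
    (ne_top_of_le_ne_top (ENat.natCast_ne_top _) h)
  rw [← hp, Nat.cast_le] at h
  refine ⟨p.getVert a, (p.take a).edist_le.trans ?_, (p.drop a).edist_le.trans ?_⟩
  · rw [SimpleGraph.Walk.take_length, Nat.cast_le]; omega
  · rw [SimpleGraph.Walk.drop_length, Nat.cast_le]; omega

theorem touch_powerGraph_iff {A B : Set V} :
    Touch (powerGraph G k) A B ↔ ∃ a ∈ A, ∃ b ∈ B, G.edist a b ≤ k := by
  simp only [Touch, powerGraph_adj_or_eq]

theorem touch_iff {A B : Set V} :
    Touch G A B ↔ ∃ a ∈ A, ∃ b ∈ B, G.edist a b ≤ (1 : ℕ) := by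
  conv_lhs => rw [← powerGraph_one G]
  exact touch_powerGraph_iff

/-! ### Induced cycles in powers -/

/-- An induced cycle of length at least four, with its vertices indexed by `ℤ/n`. -/
theorem exists_cycle_of_not_isChordal {H : SimpleGraph V} (h : ¬ IsChordal H) :
    ∃ n : ℕ, 4 ≤ n ∧ ∃ x : ZMod n → V, Function.Injective x ∧
      ∀ i j, H.Adj (x i) (x j) ↔ j = i + 1 ∨ i = j + 1 := by
  simp only [IsChordal] at h
  push Not at h
  obtain ⟨n, hn, ⟨f⟩⟩ := h
  refine ⟨n, hn, ?_⟩
  obtain ⟨m, rfl⟩ : ∃ m, n = m + 2 := ⟨n - 2, by omega⟩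
  refine ⟨fun i => f i, f.injective, fun i j => ?_⟩
  have := (f.map_rel_iff (a := i) (b := j)).trans SimpleGraph.cycleGraph_adj
  refine this.trans ?_
  change (i - j : ZMod (m + 2)) = 1 ∨ (j - i : ZMod (m + 2)) = 1 ↔ _
  rw [sub_eq_iff_eq_add', sub_eq_iff_eq_add', or_comm]

/-- On a cycle indexed by `ℤ/n`, positions counted from a base point `i` and related by a
relation that holds only between equal or consecutive positions are equal or consecutive, up to
the wrap-around between `0` and `n - 1`. -/
theorem cyclic_positions {n : ℕ} (R : ZMod n → ZMod n → Prop)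
    (hR : ∀ i j, R i j → i = j ∨ j = i + 1 ∨ i = j + 1) (i : ZMod n) {a b : ℕ}
    (ha : a < n) (hb : b < n) (h : R (i + a) (i + b)) :
    a = b ∨ b = a + 1 ∨ a = b + 1 ∨ a = 0 ∧ b = n - 1 ∨ b = 0 ∧ a = n - 1 := by
  have inj : ∀ c d : ℕ, c < n → d < n → (c : ZMod n) = d → c = d := by
    intro c d hc hd h
    rw [ZMod.natCast_eq_natCast_iff'] at h
    rwa [Nat.mod_eq_of_lt hc, Nat.mod_eq_of_lt hd] at h
  have succ : ∀ c d : ℕ, c < n → d < n → i + (c : ZMod n) = i + d + 1 →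
      c = d + 1 ∨ c = 0 ∧ d = n - 1 := by
    intro c d hc hd h
    rw [add_assoc, add_right_inj] at h
    by_cases hdn : d + 1 < n
    · exact Or.inl (inj _ _ hc hdn (by push_cast; exact h))
    · have hdn' : d + 1 = n := by omega
      refine Or.inr ⟨inj _ _ hc (by omega) ?_, by omega⟩
      rw [h, Nat.cast_zero, ← Nat.cast_add_one, hdn', ZMod.natCast_self]
  rcases hR _ _ h with h | h | h
  · exact Or.inl (inj _ _ ha hb (add_left_cancel h))
  · have := succ b a hb ha h; tauto
  · have := succ a b ha hb h; tauto

/-- The union of consecutive sets `B b, …, B (b + l)` in a chain of touching connected sets is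
connected. -/
theorem isConnSet_arc {H : SimpleGraph V} {B : ℕ → Set V} (hB : ∀ t, IsConnSet H (B t))
    (hT : ∀ t, Touch H (B t) (B (t + 1))) (b l : ℕ) :
    IsConnSet H {v | ∃ t ≤ l, v ∈ B (b + t)} := by
  induction l with
  | zero =>
    convert hB b using 1
    ext v
    simp
  | succ l ih =>
    have hsub : B (b + l) ⊆ {v | ∃ t ≤ l, v ∈ B (b + t)} := fun v hv => ⟨l, le_rfl, hv⟩
    have := ih.union (hB (b + l + 1)) ((hT (b + l)).mono hsub subset_rfl)
    convert this using 1
    ext v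
    constructor
    · rintro ⟨t, ht, hv⟩
      by_cases htl : t ≤ l
      · exact Or.inl ⟨t, htl, hv⟩
      · obtain rfl : t = l + 1 := by omega
        exact Or.inr hv
    · rintro (⟨t, ht, hv⟩ | hv)
      · exact ⟨t, by omega, hv⟩
      · exact ⟨l + 1, le_rfl, hv⟩

/-- Duchet's theorem: if the `k`-th power is chordal, so is the `(k + 2)`-nd. Along an induced cycle
of the latter, the balls of radius one are connected in the `k`-th power, and two of them touch
there exactly when their centres are at distance at most `k + 2`. -/
theorem IsChordal.powerGraph_add_two [Finite V] (hk : 1 ≤ k)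
    (h : IsChordal (powerGraph G k)) :
    IsChordal (powerGraph G (k + 2)) := by
  by_contra hn
  obtain ⟨n, hn4, x, hinj, hx⟩ := exists_cycle_of_not_isChordal hn
  have hR : ∀ i j, G.edist (x i) (x j) ≤ (k + 2 : ℕ) → i = j ∨ j = i + 1 ∨ i = j + 1 := by
    intro i j hij
    rcases powerGraph_adj_or_eq.2 hij with h' | h'
    · exact Or.inr ((hx i j).1 h')
    · exact Or.inl (hinj h')
  let X : ℕ → V := fun a => x (0 + a)
  have far : ∀ {a b : ℕ}, a < n → b < n → G.edist (X a) (X b) ≤ (k + 2 : ℕ) → _ :=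
    fun {a b} ha hb hab => cyclic_positions (fun i j => G.edist (x i) (x j) ≤ (k + 2 : ℕ)) hR 0
      ha hb hab
  have hXn : X n = X 0 := by simp [X]
  have hstep : ∀ a, G.edist (X a) (X (a + 1)) ≤ (k + 2 : ℕ) := by
    intro a
    refine powerGraph_adj_or_eq.1 (Or.inl ((hx _ _).2 (Or.inl ?_)))
    push_cast
    ring
  let B : ℕ → Set V := fun a => {v | G.edist (X a) v ≤ (1 : ℕ)}
  have hB : ∀ a, IsConnSet (powerGraph G k) (B a) := by
    intro a
    refine isConnSet_star _ (a := X a) (by simp [B]) fun b hb => powerGraph_adj_or_eq.2 ?_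
    exact le_trans hb (Nat.cast_le.2 hk)
  have hT : ∀ a, Touch (powerGraph G k) (B a) (B (a + 1)) := by
    intro a
    obtain ⟨u, h1, h2⟩ := exists_edist_le_of_le_add (a := 1) (b := k + 1)
      (by rw [show 1 + (k + 1) = k + 2 by omega]; exact hstep a)
    obtain ⟨w, h3, h4⟩ := exists_edist_le_of_le_add h2
    exact touch_powerGraph_iff.2 ⟨u, h1, w, by rw [SimpleGraph.edist_comm] at h4; exact h4, h3⟩
  have hfar : ∀ {a b}, Touch (powerGraph G k) (B a) (B b) →
      G.edist (X a) (X b) ≤ (k + 2 : ℕ) := by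
    intro a b hab
    obtain ⟨u, hu, w, hw, huw⟩ := touch_powerGraph_iff.1 hab
    have hw' : G.edist w (X b) ≤ (1 : ℕ) := by rw [SimpleGraph.edist_comm]; exact hw
    have := edist_le_add (edist_le_add hu huw) hw'
    rwa [show 1 + k + 1 = k + 2 by omega] at this
  have hB0 : B n = B 0 := by simp only [B, hXn]
  rcases h.touch_or_touch (hB 0) (hB 1) (hB 2) (isConnSet_arc hB hT 3 (n - 4)) (hT 0) (hT 1)
    ((hT 2).mono subset_rfl fun v hv => ⟨0, by omega, hv⟩)
    ((hT (n - 1)).mono (fun v hv => ⟨n - 4, le_rfl, by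
      rwa [show 3 + (n - 4) = n - 1 by omega]⟩) (by
      rw [show n - 1 + 1 = n by omega, hB0])) with h' | h'
  · have := far (by omega) (by omega) (hfar h'); omega
  · obtain ⟨u, hu, w, ⟨t, ht, hw⟩, huw⟩ := h'
    have := far (by omega) (by omega) (hfar ⟨u, hu, w, hw, huw⟩); omega

/-! ### Powers of sun-free chordal graphs -/

theorem IsChordal.induce {H : SimpleGraph V} (h : IsChordal H) (S : Set V) :
    IsChordal (H.induce S) :=
  fun n hn hc => h n hn (hc.trans ⟨SimpleGraph.Embedding.induce S⟩)

/-- The square of a sun-free chordal graph is chordal: an induced cycle `x i` of the square, with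
midpoints `m i` between `x i` and `x (i + 1)`, is shown to form a sun together with the `m i`. -/
theorem IsSunFreeChordal.powerGraph_two [Finite V] (h : IsSunFreeChordal G) :
    IsChordal (powerGraph G 2) := by
  by_contra hn
  obtain ⟨n, hn4, x, hinj, hx⟩ := exists_cycle_of_not_isChordal hn
  have : NeZero n := ⟨by omega⟩
  have hR : ∀ i j, G.edist (x i) (x j) ≤ (2 : ℕ) → i = j ∨ j = i + 1 ∨ i = j + 1 := by
    intro i j hij
    rcases powerGraph_adj_or_eq.2 hij with h' | h'
    · exact Or.inr ((hx i j).1 h')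
    · exact Or.inl (hinj h')
  have far : ∀ (i : ZMod n) {a b : ℕ}, a < n → b < n →
      G.edist (x (i + a)) (x (i + b)) ≤ (2 : ℕ) → _ :=
    fun i {a b} ha hb hab => cyclic_positions (fun i j => G.edist (x i) (x j) ≤ (2 : ℕ)) hR i
      ha hb hab
  have hmid : ∀ i, ∃ m, G.edist (x i) m ≤ (1 : ℕ) ∧ G.edist m (x (i + 1)) ≤ (1 : ℕ) :=
    fun i => exists_edist_le_of_le_add (a := 1) (b := 1)
      (powerGraph_adj_or_eq.1 (Or.inl ((hx _ _).2 (Or.inl rfl))))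
  choose m hxm hmx using hmid
  have near : ∀ {u v w : V}, G.edist u v ≤ (1 : ℕ) → G.edist v w ≤ (1 : ℕ) →
      G.edist u w ≤ (2 : ℕ) := fun h1 h2 => edist_le_add h1 h2
  have sym : ∀ {u v : V} {l : ℕ}, G.edist u v ≤ l → G.edist v u ≤ l := by
    intro u v l h
    rwa [SimpleGraph.edist_comm]
  -- a vertex of the cycle is near a midpoint only in the obvious cases
  have hxmid : ∀ i j, G.edist (x i) (m j) ≤ (1 : ℕ) → i = j ∨ i = j + 1 := by
    intro i j hij
    obtain ⟨b, hb, rfl⟩ : ∃ b : ℕ, b < n ∧ i = j + b :=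
      ⟨(i - j).val, ZMod.val_lt _, by simp⟩
    have h1 := far j (a := b) (b := 0) hb (by omega)
      (by simpa using near hij (sym (hxm j)))
    have h2 := far j (a := b) (b := 1) hb (by omega)
      (by simpa using near hij (hmx j))
    obtain rfl | rfl : b = 0 ∨ b = 1 := by omega
    · simp
    · simp
  -- the groups `{x i, m i}`, from which arcs of the closed walk are assembled
  let B : ZMod n → ℕ → Set V := fun i a => {x (i + a), m (i + a)}
  have hB : ∀ i a, IsConnSet G (B i a) := by
    intro i a
    refine isConnSet_star _ (a := x (i + a)) (by simp [B]) ?_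
    rintro b (rfl | rfl)
    · exact Or.inr rfl
    · exact SimpleGraph.edist_le_one_iff_adj_or_eq.1 (by exact_mod_cast hxm _)
  have hmx' : ∀ (i : ZMod n) (a : ℕ),
      G.edist (m (i + a)) (x (i + (a + 1 : ℕ))) ≤ (1 : ℕ) := by
    intro i a
    have := hmx (i + a)
    rwa [add_assoc, ← Nat.cast_add_one] at this
  have hT : ∀ i a, Touch G (B i a) (B i (a + 1)) := by
    intro i a
    exact touch_iff.2 ⟨m (i + a), by simp [B], x (i + (a + 1 : ℕ)), by simp [B], hmx' i a⟩
  have hxn : ∀ i : ZMod n, x (i + n) = x i := by simp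
  -- consecutive vertices are not adjacent in `G`: otherwise `x i`, `x (i + 1)`, the walk from
  -- `m (i + 1)` to `m (i + 2)` and the remaining arc violate `touch_or_touch`
  have hstep : ∀ i, ¬ G.edist (x i) (x (i + 1)) ≤ (1 : ℕ) := by
    intro i hi
    have hC : IsConnSet G ({m (i + (1 : ℕ))} ∪ B i 2) :=
      (isConnSet_singleton G _).union (hB i 2)
        (touch_iff.2 ⟨_, rfl, x (i + (2 : ℕ)), by simp [B], hmx' i 1⟩)
    rcases h.1.touch_or_touch (isConnSet_singleton G (x i)) (isConnSet_singleton G (x (i + 1)))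
      hC (isConnSet_arc (hB i) (hT i) 3 (n - 4))
      (touch_iff.2 ⟨_, rfl, _, rfl, hi⟩)
      (touch_iff.2 ⟨_, rfl, m (i + (1 : ℕ)), by simp, by simpa using hxm (i + 1)⟩)
      ((hT i 2).mono Set.subset_union_right fun v hv => ⟨0, by omega, hv⟩)
      (touch_iff.2 ⟨m (i + (n - 1 : ℕ)), ⟨n - 4, le_rfl, by
        rw [show 3 + (n - 4) = n - 1 by omega]; simp [B]⟩, _, rfl, by
        have := hmx' i (n - 1)
        rwa [show n - 1 + 1 = n by omega, hxn] at this⟩) with h' | h'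
    · have hfar : ¬ G.edist (x i) (x (i + (2 : ℕ))) ≤ (2 : ℕ) := by
        intro h2
        have := far i (a := 0) (b := 2) (by omega) (by omega) (by simpa using h2)
        omega
      obtain ⟨_, rfl, b, hb, hab⟩ := touch_iff.1 h'
      rcases hb with rfl | rfl | rfl
      · exact hfar (near hab (hmx' i 1))
      · exact hfar (hab.trans (by norm_num))
      · exact hfar (near hab (sym (hxm _)))
    · obtain ⟨_, rfl, b, ⟨t, ht, hb⟩, hab⟩ := touch_iff.1 h'
      have hfar : ¬ G.edist (x (i + 1)) (x (i + (3 + t : ℕ))) ≤ (2 : ℕ) := by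
        intro h2
        have := far i (a := 1) (b := 3 + t) (by omega) (by omega) (by simpa using h2)
        omega
      rcases hb with rfl | rfl
      · exact hfar (hab.trans (by norm_num))
      · exact hfar (near hab (sym (hxm _)))
  have hxm_ne : ∀ i j, x i ≠ m j := by
    intro i j hij
    rcases hxmid i j (by rw [hij]; simp) with rfl | rfl
    · exact hstep i (by rw [hij]; exact hmx i)
    · exact hstep j (by rw [hij]; exact hxm j)
  have adj_of : ∀ {u v}, u ≠ v → G.edist u v ≤ (1 : ℕ) → G.Adj u v := by
    intro u v huv h
    exact (SimpleGraph.edist_le_one_iff_adj_or_eq.1 (by exact_mod_cast h)).resolve_right huv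
  have of_adj : ∀ {u v}, G.Adj u v → G.edist u v ≤ (1 : ℕ) := by
    intro u v h
    exact_mod_cast SimpleGraph.edist_le_one_iff_adj_or_eq.2 (Or.inl h)
  have hm_inj : Function.Injective m := by
    intro i j hij
    have h1 := hxmid i j (by rw [← hij]; exact hxm i)
    have h2 := hxmid (i + 1) j (by rw [← hij]; exact sym (hmx i))
    rcases h1 with h1 | h1
    · exact h1
    · rcases h2 with h2 | h2
      · exfalso
        have := far j (a := 0) (b := 2) (by omega) (by omega) (by
          have h3 : j + (2 : ℕ) = j := by
            push_cast
            linear_combination h2 - h1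
          rw [h3]; simp)
        omega
      · exact add_right_cancel h2
  -- consecutive midpoints are adjacent: otherwise `x (i + 1)`, `m (i + 1)`, the arc from
  -- `x (i + 2)` around to `x i`, and `m i` violate `touch_or_touch`
  have hmm : ∀ i, G.Adj (m i) (m (i + 1)) := by
    intro i
    by_contra hna
    have hC : IsConnSet G ({v | ∃ t ≤ n - 3, v ∈ B i (2 + t)} ∪ {x i}) :=
      (isConnSet_arc (hB i) (hT i) 2 (n - 3)).union (isConnSet_singleton G _)
        (touch_iff.2 ⟨m (i + (n - 1 : ℕ)), ⟨n - 3, le_rfl, by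
          rw [show 2 + (n - 3) = n - 1 by omega]; simp [B]⟩, _, rfl, by
          have := hmx' i (n - 1)
          rwa [show n - 1 + 1 = n by omega, hxn] at this⟩)
    rcases h.1.touch_or_touch (isConnSet_singleton G (x (i + 1)))
      (isConnSet_singleton G (m (i + 1))) hC (isConnSet_singleton G (m i))
      (touch_iff.2 ⟨_, rfl, _, rfl, hxm _⟩)
      (touch_iff.2 ⟨_, rfl, x (i + (2 : ℕ)), Or.inl ⟨0, by omega, by simp [B]⟩,
        by simpa using hmx' i 1⟩)
      (touch_iff.2 ⟨x i, Or.inr rfl, _, rfl, hxm i⟩)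
      (touch_iff.2 ⟨_, rfl, _, rfl, hmx i⟩) with h' | h'
    · obtain ⟨_, rfl, b, hb, hab⟩ := touch_iff.1 h'
      rcases hb with ⟨t, ht, hb⟩ | rfl
      · have h1 : G.edist (x (i + 1)) (x (i + (2 + t : ℕ))) ≤ (2 : ℕ) := by
          rcases hb with rfl | rfl
          · exact hab.trans (by norm_num)
          · exact near hab (sym (hxm _))
        have ht0 := far i (a := 1) (b := 2 + t) (by omega) (by omega) (by simpa using h1)
        obtain rfl : t = 0 := by omega
        rcases hb with rfl | rfl
        · refine hstep (i + 1) ?_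
          simpa [add_assoc, one_add_one_eq_two] using hab
        · have h2 := far i (a := 1) (b := 3) (by omega) (by omega)
            (by simpa using near hab (hmx' i 2))
          omega
      · exact hstep i (sym hab)
    · obtain ⟨_, rfl, _, rfl, hab⟩ := touch_iff.1 h'
      refine hna (adj_of (fun heq => ?_) (sym hab))
      have := hm_inj heq
      have h2 := hstep i
      rw [← this] at h2
      simp at h2
  refine h.2 (Set.range x ∪ Set.range m) ⟨h.1.induce _, n, by omega,
    fun i => ⟨x i, Or.inl ⟨i, rfl⟩⟩, fun i => ⟨m i, Or.inr ⟨i, rfl⟩⟩, ⟨?_, ?_⟩, ?_, ?_, ?_⟩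
  · rintro (i | i) (j | j) hij
    · exact congrArg Sum.inl (hinj (congrArg Subtype.val hij))
    · exact absurd (congrArg Subtype.val hij) (hxm_ne i j)
    · exact absurd (congrArg Subtype.val hij).symm (hxm_ne j i)
    · exact congrArg Sum.inr (hm_inj (congrArg Subtype.val hij))
  · rintro ⟨v, ⟨i, rfl⟩ | ⟨i, rfl⟩⟩
    · exact ⟨Sum.inl i, rfl⟩
    · exact ⟨Sum.inr i, rfl⟩
  · intro i j hij
    have hadj : G.Adj (x i) (x j) := hij
    rcases hR i j ((of_adj hadj).trans (by norm_num)) with rfl | rfl | rfl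
    · exact hadj.ne rfl
    · exact hstep i (of_adj hadj)
    · exact hstep j (sym (of_adj hadj))
  · exact hmm
  · intro i j
    change G.Adj (x i) (m j) ↔ _
    refine ⟨fun hadj => hxmid i j (of_adj hadj), ?_⟩
    rintro (rfl | rfl)
    · exact adj_of (hxm_ne _ _) (hxm _)
    · exact adj_of (hxm_ne _ _) (sym (hmx _))

theorem IsSunFreeChordal.isChordal_powerGraph [Finite V] (h : IsSunFreeChordal G) (hk : 0 < k) :
    IsChordal (powerGraph G k) := by
  induction k using Nat.strong_induction_on with
  | _ k ih =>
  match k, hk with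
  | 1, _ => rw [powerGraph_one]; exact h.1
  | 2, _ => exact h.powerGraph_two
  | k + 3, _ => exact (ih (k + 1) (by omega) (by omega)).powerGraph_add_two (by omega)

/-! ### Clique partitions and independent sets in chordal graphs -/

/-- Peeling off closed neighbourhoods of simplicial vertices yields an independent set `S` and a
partition of `U` into cliques, the fibres of `f`, indexed by the vertices of `S`. -/
theorem IsChordal.exists_clique_partition [Finite V] (hH : IsChordal H) (U : Set V) :
    ∃ (S : Finset V) (f : V → V), (S : Set V) ⊆ U ∧ (∀ a ∈ S, ∀ b ∈ S, ¬ H.Adj a b) ∧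
      (∀ u ∈ U, f u ∈ S) ∧ ∀ u ∈ U, ∀ v ∈ U, f u = f v → u ≠ v → H.Adj u v := by
  classical
  induction U using WellFoundedLT.induction with
  | ind U ih =>
  rcases U.eq_empty_or_nonempty with rfl | hU
  · exact ⟨∅, id, by simp⟩
  obtain ⟨s, hsU, hs⟩ := hH.exists_isSimplicialIn hU
  set U' : Set V := {u | u ∈ U ∧ u ≠ s ∧ ¬ H.Adj s u} with hU'
  obtain ⟨S, f, hSU, hS, hfS, hf⟩ := ih U' ⟨fun u hu => hu.1, fun h => (h hsU).2.1 rfl⟩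
  have hsS : s ∉ S := fun h => (hSU h).2.1 rfl
  refine ⟨insert s S, fun u => if u = s ∨ H.Adj s u then s else f u, ?_, ?_, ?_, ?_⟩
  · intro u hu
    rcases Finset.mem_insert.1 hu with rfl | hu
    · exact hsU
    · exact (hSU hu).1
  · intro a ha b hb hab
    rcases Finset.mem_insert.1 ha with rfl | ha' <;> rcases Finset.mem_insert.1 hb with rfl | hb'
    · exact hab.ne rfl
    · exact (hSU hb').2.2 hab
    · exact (hSU ha').2.2 hab.symm
    · exact hS a ha' b hb' hab
  · intro u hu
    by_cases h : u = s ∨ H.Adj s u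
    · simp [h]
    · simp only [h, if_false]
      push Not at h
      exact Finset.mem_insert_of_mem (hfS u ⟨hu, h⟩)
  · intro u hu v hv huv hne
    by_cases h1 : u = s ∨ H.Adj s u <;> by_cases h2 : v = s ∨ H.Adj s v
    · rcases h1 with rfl | h1
      · exact h2.resolve_left hne.symm
      · rcases h2 with rfl | h2
        · exact h1.symm
        · exact hs u hu v hv h1 h2 hne
    · simp only [h1, h2, if_true, if_false] at huv
      push Not at h2
      exact absurd (huv ▸ hfS v ⟨hv, h2⟩) hsS
    · simp only [h1, h2, if_true, if_false] at huv
      push Not at h1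
      exact absurd (huv ▸ hfS u ⟨hu, h1⟩) hsS
    · simp only [h1, h2, if_false] at huv
      push Not at h1 h2
      exact hf u ⟨hu, h1⟩ v ⟨hv, h2⟩ huv hne

/-- If `C` is a clique of a chordal graph, some independent set outside `C` has a neighbour of every
vertex of `C` that has a neighbour outside `C` at all. The set is chosen greedily along a
simplicial elimination ordering that ends with `C`, from its last vertex to its first. -/
theorem IsChordal.exists_independent_dominating_clique [Finite V] (hH : IsChordal H) {C : Set V}
    (hC : H.IsClique C) (U : Set V) : C ⊆ U →
    ∃ I : Finset V, (I : Set V) ⊆ U \ C ∧ (∀ a ∈ I, ∀ b ∈ I, ¬ H.Adj a b) ∧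
      ∀ c ∈ C, (∃ z ∈ U \ C, H.Adj c z) → ∃ z ∈ I, H.Adj c z := by
  classical
  induction U using WellFoundedLT.induction with
  | ind U ih =>
  intro hCU
  rcases hCU.eq_or_ssubset with rfl | hlt
  · exact ⟨∅, by simp⟩
  obtain ⟨s, hsC, hsU, hs⟩ := hH.exists_isSimplicialIn_notMem U C hlt hC
  obtain ⟨I, hIU, hI, hdom⟩ := ih (U \ {s})
    ⟨Set.sdiff_subset, fun h => (h hsU).2 rfl⟩ (fun c hc => ⟨hCU hc, fun h => hsC (h ▸ hc)⟩)
  by_cases hsI : ∃ i ∈ I, H.Adj s i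
  · obtain ⟨i, hi, hsi⟩ := hsI
    refine ⟨I, fun j hj => ⟨(hIU hj).1.1, (hIU hj).2⟩, hI, ?_⟩
    rintro c hc ⟨z, hz, hcz⟩
    by_cases hzs : z = s
    · subst hzs
      exact ⟨i, hi, hs c (hCU hc) i (hIU hi).1.1 hcz.symm hsi fun h => (hIU hi).2 (h ▸ hc)⟩
    · exact hdom c hc ⟨z, ⟨⟨hz.1, hzs⟩, hz.2⟩, hcz⟩
  · push Not at hsI
    refine ⟨insert s I, ?_, ?_, ?_⟩
    · intro j hj
      rcases Finset.mem_insert.1 hj with rfl | hj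
      · exact ⟨hsU, hsC⟩
      · exact ⟨(hIU hj).1.1, (hIU hj).2⟩
    · intro a ha b hb hab
      rcases Finset.mem_insert.1 ha with rfl | ha' <;> rcases Finset.mem_insert.1 hb with rfl | hb'
      · exact hab.ne rfl
      · exact hsI b hb' hab
      · exact hsI a ha' hab.symm
      · exact hI a ha' b hb' hab
    · rintro c hc ⟨z, hz, hcz⟩
      by_cases hzs : z = s
      · subst hzs
        exact ⟨z, by simp, hcz⟩
      · obtain ⟨i, hi, hci⟩ := hdom c hc ⟨z, ⟨⟨hz.1, hzs⟩, hz.2⟩, hcz⟩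
        exact ⟨i, by simp [hi], hci⟩

/-! ### Packings and dominating sets -/

/-- A `k`-packing is an independent set of the `k`-th power. -/
theorem isPacking_iff {P : Finset V} :
    IsPacking G k P ↔ ∀ a ∈ P, ∀ b ∈ P, ¬ (powerGraph G k).Adj a b := by
  refine forall₂_congr fun a _ => forall₂_congr fun b _ => ?_
  rw [← not_le, ← not_and]
  rfl

theorem IsPacking.exists_maximal [Finite V] {P : Finset V} (hP : IsPacking G k P) :
    ∃ Q, P ⊆ Q ∧ Maximal (IsPacking G k) Q :=
  (Set.toFinite {Q : Finset V | IsPacking G k Q}).exists_le_maximal hP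

theorem IsPacking.mono {l : ℕ} (hkl : k ≤ l) {P : Finset V} (hP : IsPacking G l P) :
    IsPacking G k P :=
  fun u hu v hv h => (Nat.cast_le.2 hkl).trans_lt (hP u hu v hv h)

theorem isDominating_of_maximal {P : Finset V} (hP : Maximal (IsPacking G k) P) :
    IsDominating G k P := by
  classical
  intro v
  by_contra! hv
  have hvP : v ∉ P := fun h => by simpa using hv v h
  have : IsPacking G k (insert v P) := by
    intro a ha b hb hab
    rcases Finset.mem_insert.1 ha with rfl | ha' <;> rcases Finset.mem_insert.1 hb with rfl | hb'
    · exact absurd rfl hab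
    · rw [SimpleGraph.edist_comm]; exact hv b hb'
    · exact hv a ha'
    · exact hP.1 a ha' b hb' hab
  exact hvP (hP.2 this (Finset.subset_insert v P) (Finset.mem_insert_self v P))

theorem IsPacking.card_le_of_isDominating {P D : Finset V} (hP : IsPacking G (2 * k) P)
    (hD : IsDominating G k D) : P.card ≤ D.card := by
  choose f hfD hf using hD
  refine Finset.card_le_card_of_injOn f (fun v _ => hfD v) fun u hu v hv huv => ?_
  by_contra hne
  refine (hP u hu v hv hne).not_ge ?_
  rw [two_mul]
  refine edist_le_add (v := f u) ?_ ?_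
  · rw [SimpleGraph.edist_comm]; exact hf u
  · rw [huv]; exact hf v

theorem IsPacking.card_le_packingNumber [Finite V] {P : Finset V} (hP : IsPacking G k P) :
    P.card ≤ packingNumber G k := by
  have := Fintype.ofFinite V
  refine le_csSup ⟨Fintype.card V, ?_⟩ ⟨P, hP, rfl⟩
  rintro _ ⟨Q, -, rfl⟩
  exact Q.card_le_univ

theorem exists_isPacking_card_eq [Finite V] (G : SimpleGraph V) (k : ℕ) :
    ∃ P, IsPacking G k P ∧ P.card = packingNumber G k := by
  have := Fintype.ofFinite V
  refine Nat.sSup_mem (s := {n : ℕ | ∃ P : Finset V, IsPacking G k P ∧ P.card = n})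
    ⟨0, ∅, by simp [IsPacking], rfl⟩ ⟨Fintype.card V, ?_⟩
  rintro _ ⟨Q, -, rfl⟩
  exact Q.card_le_univ

theorem IsDominating.dominationNumber_le {D : Finset V} (hD : IsDominating G k D) :
    dominationNumber G k ≤ D.card :=
  Nat.sInf_le ⟨D, hD, rfl⟩

theorem exists_isDominating_card_eq [Finite V] (G : SimpleGraph V) (k : ℕ) :
    ∃ D, IsDominating G k D ∧ D.card = dominationNumber G k := by
  have := Fintype.ofFinite V
  exact Nat.sInf_mem (s := {n : ℕ | ∃ D : Finset V, IsDominating G k D ∧ D.card = n})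
    ⟨_, Finset.univ, fun v => ⟨v, Finset.mem_univ v, by simp⟩, rfl⟩

theorem dominationNumber_le_packingNumber [Finite V] (G : SimpleGraph V) (k : ℕ) :
    dominationNumber G k ≤ packingNumber G k := by
  obtain ⟨P, -, hP⟩ := IsPacking.exists_maximal (G := G) (k := k) (P := ∅) (by simp [IsPacking])
  exact (isDominating_of_maximal hP).dominationNumber_le.trans hP.1.card_le_packingNumber

theorem packingNumber_two_mul_le_dominationNumber [Finite V] (G : SimpleGraph V) (k : ℕ) :
    packingNumber G (2 * k) ≤ dominationNumber G k := by
  obtain ⟨P, hP, hPc⟩ := exists_isPacking_card_eq G (2 * k)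
  obtain ⟨D, hD, hDc⟩ := exists_isDominating_card_eq G k
  rw [← hPc, ← hDc]
  exact hP.card_le_of_isDominating hD

theorem isEquipackable_of_dominationNumber_eq [Finite V]
    (h : dominationNumber G k = packingNumber G k) : IsEquipackable k G := by
  have key : ∀ P, Maximal (IsPacking G k) P → P.card = packingNumber G k := fun P hP =>
    le_antisymm hP.1.card_le_packingNumber
      (h ▸ (isDominating_of_maximal hP).dominationNumber_le)
  intro P Q hP hQ
  rw [key P hP, key Q hQ]

theorem dominationNumber_eq_of_inClassR [Finite V] (h : InClassR k G) :
    dominationNumber G k = packingNumber G k :=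
  le_antisymm (dominationNumber_le_packingNumber G k)
    (h.trans_le (packingNumber_two_mul_le_dominationNumber G k))

/-- If the `k`-th power is chordal and all maximal `k`-packings have the same size, then every class
of the clique partition contains a vertex whose closed neighbourhood (in the power) stays in the
class. One such vertex per class gives a `2k`-packing as large as any `k`-packing. -/
theorem IsEquipackable.inClassR [Finite V] (hE : IsEquipackable k G)
    (hH : IsChordal (powerGraph G k)) : InClassR k G := by
  classical
  obtain ⟨S, f, -, hS, hfS, hf⟩ := hH.exists_clique_partition Set.univ
  have hcard : ∀ P, IsPacking G k P → P.card ≤ S.card := by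
    intro P hP
    refine Finset.card_le_card_of_injOn f (fun v _ => hfS v trivial) fun u hu v hv huv => ?_
    by_contra hne
    exact isPacking_iff.1 hP u hu v hv (hf u trivial v trivial huv hne)
  have hSp : IsPacking G k S := isPacking_iff.2 hS
  have hSmax : Maximal (IsPacking G k) S :=
    ⟨hSp, fun Q hQ hSQ => (Finset.eq_of_subset_of_card_le hSQ (hcard Q hQ)).ge⟩
  have hmeet : ∀ P, Maximal (IsPacking G k) P → ∀ s ∈ S, ∃ p ∈ P, f p = s := by
    intro P hP s hs
    refine Finset.surj_on_of_inj_on_of_card_le (s := P) (t := S) (fun p _ => f p)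
      (fun p _ => hfS p trivial) (fun u v hu hv huv => ?_) (hE S P hSmax hP).le s hs |>.imp ?_
    · by_contra hne
      exact isPacking_iff.1 hP.1 u hu v hv (hf u trivial v trivial huv hne)
    · rintro p ⟨hp, h⟩
      exact ⟨hp, h.symm⟩
  have hw : ∀ s ∈ S, ∃ w, f w = s ∧ ∀ v, G.edist w v ≤ k → f v = s := by
    intro s hs
    by_contra! hno
    -- an independent set dominating the class from outside extends to a maximal one, which misses
    -- the class
    obtain ⟨I, hIC, hI, hdom⟩ := hH.exists_independent_dominating_clique (C := {v | f v = s})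
      (fun u hu v hv hne => hf u trivial v trivial (hu.trans hv.symm) hne) Set.univ
      (Set.subset_univ _)
    obtain ⟨J, hIJ, hJ⟩ := (isPacking_iff.2 hI).exists_maximal
    obtain ⟨c, hcJ, hc⟩ := hmeet J hJ s hs
    obtain ⟨v, hcv, hv⟩ := hno c hc
    obtain ⟨z, hz, hcz⟩ := hdom c hc ⟨v, ⟨trivial, hv⟩, by
      refine (powerGraph_adj_or_eq.2 hcv).resolve_right ?_
      rintro rfl
      exact hv hc⟩
    exact isPacking_iff.1 hJ.1 c hcJ z (hIJ hz) hcz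
  choose! w hws hwN using hw
  have hWinj : Set.InjOn w S := by
    intro s hs t ht hst
    rw [← hws s hs, ← hws t ht, hst]
  have hW : IsPacking G (2 * k) (S.image w) := by
    intro a ha b hb hab
    obtain ⟨s, hs, rfl⟩ := Finset.mem_image.1 ha
    obtain ⟨t, ht, rfl⟩ := Finset.mem_image.1 hb
    by_contra! hle
    rw [two_mul] at hle
    obtain ⟨v, h1, h2⟩ := exists_edist_le_of_le_add hle
    rw [SimpleGraph.edist_comm] at h2
    exact hab (by rw [← hwN s hs v h1, hwN t ht v h2])
  obtain ⟨P, hP, hPc⟩ := exists_isPacking_card_eq G k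
  obtain ⟨Q, hQ, hQc⟩ := exists_isPacking_card_eq G (2 * k)
  refine le_antisymm ?_ ?_
  · calc packingNumber G k = P.card := hPc.symm
      _ ≤ S.card := hcard P hP
      _ = (S.image w).card := (Finset.card_image_of_injOn hWinj).symm
      _ ≤ _ := hW.card_le_packingNumber
  · rw [← hQc]
    exact (hQ.mono (by omega)).card_le_packingNumber

end GraphPacking

theorem theorem4 {V : Type*} [Finite V] (G : SimpleGraph V) (k : ℕ) (hk : 0 < k) :
    (GraphPacking.IsSunFreeChordal G →
      (GraphPacking.dominationNumber G k = GraphPacking.packingNumber G k ↔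
        GraphPacking.InClassR k G)) ∧
    (GraphPacking.dominationNumber G k = GraphPacking.packingNumber G k →
      GraphPacking.IsEquipackable k G) ∧
    (GraphPacking.InClassR k G → GraphPacking.IsEquipackable k G) := by
  refine ⟨fun hG => ⟨fun h => ?_, GraphPacking.dominationNumber_eq_of_inClassR⟩,
    GraphPacking.isEquipackable_of_dominationNumber_eq, fun h =>
    GraphPacking.isEquipackable_of_dominationNumber_eq
      (GraphPacking.dominationNumber_eq_of_inClassR h)⟩
  exact (GraphPacking.isEquipackable_of_dominationNumber_eq h).inClassR
    (hG.isChordal_powerGraph hk)
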